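/- **Setting.** All Hilbert spaces are finite dimensional, of the form $\mathbb C^n$ with the standard basis; $A^*$ and $A^T$ denote entrywise complex conjugation and transposition, $\mathcal L(\mathcal H)$ is the space of linear operators on $\mathcal H$, and $|A\rangle\!\rangle=\sum_{n,m}\langle n|A|m\rangle\,|n\rangle|m\rangle$. The Choi operator of a linear map $\mathcal C:\mathcal L(\mathcal H_{\rm in})\to\mathcal L(\mathcal H_{\rm out})$ is $(\mathcal C\otimes\mathcal I)(|I\rangle\!\rangle\langle\!\langle I|)\in\mathcal L(\mathcal H_{\rm out}\otimes\mathcal H_{\rm in})$. For operators $M,N$ on tensor products of spaces labelled by sets $\mathsf I,\mathsf J$, the link product is $M*N=\operatorname{Tr}_{\mathsf I\cap\mathsf J}[(I_{\mathsf J\setminus\mathsf I}\otimes M^{T_{\mathsf I\cap\mathsf J}})(I_{\mathsf I\setminus\mathsf J}\otimes N)]$, tensor factors being reordered as needed. A (deterministic) $1$-comb on $(\mathcal H_{\rm in},\mathcal H_{\rm out})$ is the Choi operator of a completely positive map (of a channel, i.e. a completely positive trace-preserving map) $\mathcal L(\mathcal H_{\rm in})\to\mathcal L(\mathcal H_{\rm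 out})$. A deterministic $2$-comb on $(\mathcal K_0,\mathcal K_1,\mathcal K_2,\mathcal K_3)$ is the Choi operator of a completely positive linear map sending $1$-combs on $(\mathcal K_1,\mathcal K_2)$ to $1$-combs on $(\mathcal K_0,\mathcal K_3)$, and deterministic ones to deterministic ones. A deterministic $(1^{\otimes N},1)$-comb on $\mathcal H_0,\dots,\mathcal H_{2N+1}$ is the Choi operator of a completely positive linear map that sends every tensor product $C_1\otimes\dots\otimes C_N$ of $1$-combs $C_i$ on $(\mathcal H_{2i-1},\mathcal H_{2i})$ to a $1$-comb on $(\mathcal H_0,\mathcal H_{2N+1})$, and every tensor product of deterministic $1$-combs to a deterministic $1$-comb. **Statement.** Let $G$ be a group (for instance a compact group), let $U^{(i)}$ ($i=1,\dots,N$) be unitary representations of $G$ on $\mathcal H_{2i-1}\cong\mathcal H_{2i}\cong\mathbb C^{d_i}$ and $V$ a unitary representation of $G$ on $\mathcal H_0\cong\mathcal H_{2N+1}\cong\mathbb C^{d_0}$. Put $U_g=\bigotimes_{i=1}^N U^{(i)}_g$, $W_g=U_g^*\otimes V_g$, $\mathcal H_A=\bigotimes_i\mathcal H_{2i-1}$ and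 $\mathcal H_B=\bigotimes_i\mathcal H_{2i}$, so that $|U_g\rangle\!\rangle\in\mathcal H_B\otimes\mathcal H_A$. Let $R$ be a deterministic $(1^{\otimes N},1)$-comb on $\mathcal H_0,\dots,\mathcal H_{2N+1}$ such that $$[R,\;W_h^*\otimes W_g]=0\qquad\text{for all }g,h\in G,$$ where $W_h^*=U_h\otimes V_h^*$ acts on $\mathcal H_A\otimes\mathcal H_0$ and $W_g=U_g^*\otimes V_g$ acts on $\mathcal H_B\otimes\mathcal H_{2N+1}$. Then there are a memory space $\mathcal H_M$ and channels $\mathcal C_1:\mathcal L(\mathcal H_0)\to\mathcal L(\mathcal H_A\otimes\mathcal H_M)$ and $\mathcal C_2:\mathcal L(\mathcal H_B\otimes\mathcal H_M)\to\mathcal L(\mathcal H_{2N+1})$, with Choi operators $C_1,C_2$, such that $R'=C_1*C_2$ (link over $\mathcal H_M$) is a deterministic $2$-comb on $(\mathcal H_0,\mathcal H_A,\mathcal H_B,\mathcal H_{2N+1})$ and $$R*|U_g\rangle\!\rangle\langle\!\langle U_g|=R'*|U_g\rangle\!\rangle\langle\!\langle U_g|=C_1*|U_g\rangle\!\rangle\langle\!\langle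 U_g|*C_2\qquad\text{for all }g\in G.$$ More precisely, this holds for the following choice. Let $S=\operatorname{Tr}_{2N+1}R$, an operator on $\mathcal H_0\otimes\mathcal H_A\otimes\mathcal H_B$, let $S^{-1/2}$ be the inverse of $S^{1/2}$ on the support of $S$ and zero on its kernel, let $\Pi_S=S^{-1/2}SS^{-1/2}$ be the projection on the support of $S$, let $\mathcal H_{0'},\mathcal H_{A'},\mathcal H_{B'}$ be copies of $\mathcal H_0,\mathcal H_A,\mathcal H_B$, and let $\mathcal H_M=\mathcal H_{0'}\otimes\mathcal H_{A'}$. With $|S^{1/2}\rangle\!\rangle\in(\mathcal H_0\otimes\mathcal H_A\otimes\mathcal H_B)\otimes(\mathcal H_{0'}\otimes\mathcal H_{A'}\otimes\mathcal H_{B'})$ one can take $$C_1=|S^{1/2}\rangle\!\rangle\langle\!\langle S^{1/2}|*|I\rangle\!\rangle\langle\!\langle I|_{BA},\qquad C_2=S^{-1/2}RS^{-1/2}+(I-\Pi_S)\otimes\tfrac1{d_0}I_{2N+1},$$ where in $C_1$ the output factor $\mathcal H_{B'}$ is identified with $\mathcal H_A$ (both are $\bigotimes_i\mathbb C^{d_i}$),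 and in $C_2$ the space $\mathcal H_0\otimes\mathcal H_A\otimes\mathcal H_B$ is identified with the input space $\mathcal H_{0'}\otimes\mathcal H_{A'}\otimes\mathcal H_B=\mathcal H_M\otimes\mathcal H_B$. -/

import Mathlib

open scoped Kronecker ComplexOrder

noncomputable section

namespace QComb

/-- Operators on the Hilbert space `ℂ^n`, written in its standard (fixed) orthonormal basis. The
tensor product of `ℂ^m` and `ℂ^n` is `ℂ^(m × n)`. -/
abbrev Op (n : Type*) := Matrix n n ℂ

/-- Regrouping or renaming of tensor factors: `f` sends a new basis label to the old one. -/
def relabel {m n : Type*} (f : m → n) (M : Op n) : Op m := M.submatrix f f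

/-- The map `Φ ⊗ id` on operators on `ℂ^n ⊗ ℂ^k`. -/
def ampliation {m n : Type*} (k : Type*) (Φ : Op n →ₗ[ℂ] Op m) (X : Op (n × k)) : Op (m × k) :=
  Matrix.of fun p q => Φ (Matrix.of fun a b => X (a, p.2) (b, q.2)) p.1 q.1

/-- Complete positivity: `Φ ⊗ id` preserves positivity for every finite-dimensional ancilla. -/
def IsCP {m n : Type*} (Φ : Op n →ₗ[ℂ] Op m) : Prop :=
  ∀ (k : ℕ) (X : Op (n × Fin k)), X.PosSemidef → (ampliation (Fin k) Φ X).PosSemidef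

/-- Quantum channels: completely positive trace-preserving linear maps. -/
def IsChannel {m n : Type*} [Fintype m] [Fintype n] (Φ : Op n →ₗ[ℂ] Op m) : Prop :=
  IsCP Φ ∧ ∀ X, (Φ X).trace = X.trace

/-- The vector `|A⟩⟩ = ∑ ⟨i|A|j⟩ |i⟩|j⟩`. -/
def dket {m n : Type*} (A : Matrix m n ℂ) : m × n → ℂ := fun p => A p.1 p.2

/-- The rank-one operator `|A⟩⟩⟨⟨A|`. -/
def ketBra {m n : Type*} (A : Matrix m n ℂ) : Op (m × n) :=
  Matrix.vecMulVec (dket A) (star (dket A))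

/-- The Choi operator `(Φ ⊗ id)(|I⟩⟩⟨⟨I|)`, an operator on (output) ⊗ (input). -/
def choi {m n : Type*} [DecidableEq n] (Φ : Op n →ₗ[ℂ] Op m) : Op (m × n) :=
  ampliation n Φ (ketBra (1 : Op n))

/-! ### Combs -/

/-- 1-combs: Choi operators of completely positive maps from `L(ℂ^n)` to `L(ℂ^m)`. -/
def IsOneComb {m n : Type*} [DecidableEq n] (C : Op (m × n)) : Prop :=
  ∃ Φ : Op n →ₗ[ℂ] Op m, IsCP Φ ∧ C = choi Φ

/-- Deterministic 1-combs: Choi operators of channels from `L(ℂ^n)` to `L(ℂ^m)`. -/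
def IsDetOneComb {m n : Type*} [Fintype m] [Fintype n] [DecidableEq n] (C : Op (m × n)) : Prop :=
  ∃ Φ : Op n →ₗ[ℂ] Op m, IsChannel Φ ∧ C = choi Φ

/-- Deterministic 2-combs on the Hilbert spaces `(ℂ^z, ℂ^a, ℂ^b, ℂ^o)`: Choi operators of the
completely positive linear maps which send 1-combs on `(ℂ^a, ℂ^b)` to 1-combs on `(ℂ^z, ℂ^o)`, and
deterministic ones to deterministic ones. -/
def IsDetTwoComb {o z b a : Type*} [Fintype o] [Fintype z] [Fintype b] [Fintype a]
    [DecidableEq z] [DecidableEq b] [DecidableEq a] (R : Op ((o × z) × (b × a))) : Prop :=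
  ∃ Φ : Op (b × a) →ₗ[ℂ] Op (o × z), IsCP Φ ∧
    (∀ C, IsOneComb C → IsOneComb (Φ C)) ∧
    (∀ C, IsDetOneComb C → IsDetOneComb (Φ C)) ∧
    R = choi Φ

/-- The tensor product of a family of matrices. -/
def tensorPi {ι : Type*} [Fintype ι] {m n : ι → Type*} (A : ∀ i, Matrix (m i) (n i) ℂ) :
    Matrix (∀ i, m i) (∀ i, n i) ℂ :=
  Matrix.of fun x y => ∏ i, A i (x i) (y i)

/-- The tensor product of operators `C i` on `ℂ^(b i) ⊗ ℂ^(a i)`, with all the factors `ℂ^(b i)`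
(outputs) put first and all the factors `ℂ^(a i)` (inputs) second. -/
def tensorCombs {ι : Type*} [Fintype ι] {b a : ι → Type*} (C : ∀ i, Op (b i × a i)) :
    Op ((∀ i, b i) × (∀ i, a i)) :=
  relabel (fun p i => (p.1 i, p.2 i)) (tensorPi C)

/-- Deterministic `(1^{⊗N}, 1)`-combs: Choi operators of the completely positive linear maps which
send tensor products of `N` 1-combs, the `i`-th one on `(ℂ^(a i), ℂ^(b i))`, to 1-combs on
`(ℂ^z, ℂ^o)`, and tensor products of deterministic 1-combs to deterministic 1-combs. -/
def IsDetParallelComb {N : ℕ} {o z : Type*} {b a : Fin N → Type*} [Fintype o] [Fintype z]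
    [∀ i, Fintype (b i)] [∀ i, Fintype (a i)] [DecidableEq z]
    [∀ i, DecidableEq (b i)] [∀ i, DecidableEq (a i)]
    (R : Op ((o × z) × ((∀ i, b i) × (∀ i, a i)))) : Prop :=
  ∃ Φ : Op ((∀ i, b i) × (∀ i, a i)) →ₗ[ℂ] Op (o × z), IsCP Φ ∧
    (∀ C : ∀ i, Op (b i × a i), (∀ i, IsOneComb (C i)) → IsOneComb (Φ (tensorCombs C))) ∧
    (∀ C : ∀ i, Op (b i × a i), (∀ i, IsDetOneComb (C i)) → IsDetOneComb (Φ (tensorCombs C))) ∧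
    R = choi Φ

/-! ### The link product -/

/-- Partial transpose on the second factor. -/
def transposeSnd {m k : Type*} (M : Op (m × k)) : Op (m × k) :=
  Matrix.of fun p q => M (p.1, q.2) (q.1, p.2)

/-- Partial trace over the first factor. -/
def traceFst {m n : Type*} [Fintype m] (M : Op (m × n)) : Op n :=
  Matrix.of fun x y => ∑ i, M (i, x) (i, y)

/-- The link product `M * N = Tr_K[(M^{T_K} ⊗ I)(I ⊗ N)]` of operators `M` on `ℂ^m ⊗ ℂ^k` and `N`
on `ℂ^k ⊗ ℂ^n`, over the common factor `ℂ^k`. -/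
def link {m k n : Type*} [Fintype m] [Fintype k] [Fintype n] [DecidableEq m] [DecidableEq n]
    (M : Op (m × k)) (N : Op (k × n)) : Op (m × n) :=
  traceFst (relabel (fun p : k × (m × n) => ((p.2.1, p.1), p.2.2))
    ((transposeSnd M ⊗ₖ (1 : Op n)) *
      relabel (fun p : (m × k) × n => (p.1.1, (p.1.2, p.2))) ((1 : Op m) ⊗ₖ N)))

theorem link_apply {m k n : Type*} [Fintype m] [Fintype k] [Fintype n] [DecidableEq m]
    [DecidableEq n] (M : Op (m × k)) (N : Op (k × n)) (p q : m × n) :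
    link M N p q = ∑ i, ∑ j, M (p.1, i) (q.1, j) * N (i, p.2) (j, q.2) := by
  rw [Finset.sum_comm]
  simp [link, traceFst, relabel, transposeSnd, Matrix.mul_apply, Fintype.sum_prod_type,
    Matrix.one_apply]

/-- The link product `M * T` when all the factors of `T` are factors of `M`. -/
def linkAll {m k : Type*} [Fintype m] [Fintype k] [DecidableEq m]
    (M : Op (m × k)) (T : Op k) : Op m :=
  relabel (fun i => (i, ())) (link M (relabel (fun p : k × Unit => p.1) T))

/-- The link product `C₁ * C₂` over the memory `ℂ^μ`, for `C₁` on `(ℂ^a ⊗ ℂ^μ) ⊗ ℂ^z` and `C₂` on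
`ℂ^o ⊗ (ℂ^b ⊗ ℂ^μ)`. -/
def linkMemory {o z b a μ : Type*} [Fintype o] [Fintype z] [Fintype b] [Fintype a] [Fintype μ]
    [DecidableEq o] [DecidableEq z] [DecidableEq b] [DecidableEq a]
    (C₁ : Op ((a × μ) × z)) (C₂ : Op (o × (b × μ))) : Op ((o × z) × (b × a)) :=
  relabel (fun p : (o × z) × (b × a) => ((p.1.1, p.2.1), (p.2.2, p.1.2)))
    (link (relabel (fun p : (o × b) × μ => (p.1.1, (p.1.2, p.2))) C₂)
      (relabel (fun p : μ × (a × z) => ((p.2.1, p.1), p.2.2)) C₁))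

/-- The link product `C₁ * E` over `ℂ^a`, for `C₁` on `(ℂ^a ⊗ ℂ^μ) ⊗ ℂ^z` and `E` on
`ℂ^b ⊗ ℂ^a`. -/
def linkInsert {z b a μ : Type*} [Fintype z] [Fintype b] [Fintype a] [Fintype μ]
    [DecidableEq z] [DecidableEq b] [DecidableEq μ]
    (C₁ : Op ((a × μ) × z)) (E : Op (b × a)) : Op ((b × μ) × z) :=
  relabel (fun p : (b × μ) × z => (p.1.1, (p.1.2, p.2)))
    (link E (relabel (fun p : a × (μ × z) => ((p.1, p.2.1), p.2.2)) C₁))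

/-- The link product `C₁ * E * C₂`, for `C₁` on `(ℂ^a ⊗ ℂ^μ) ⊗ ℂ^z`, `E` on `ℂ^b ⊗ ℂ^a` and `C₂`
on `ℂ^o ⊗ (ℂ^b ⊗ ℂ^μ)`. -/
def linkCircuit {o z b a μ : Type*} [Fintype o] [Fintype z] [Fintype b] [Fintype a] [Fintype μ]
    [DecidableEq o] [DecidableEq z] [DecidableEq b] [DecidableEq μ]
    (C₁ : Op ((a × μ) × z)) (E : Op (b × a)) (C₂ : Op (o × (b × μ))) : Op (o × z) :=
  link C₂ (linkInsert C₁ E)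

/-! ### The explicit preprocessing and postprocessing operators -/

section Explicit

variable {o z a : Type*} [Fintype o] [Fintype z] [Fintype a]
  [DecidableEq o] [DecidableEq z] [DecidableEq a]

/-- `S = Tr_o[R]`, an operator on `ℂ^z ⊗ (ℂ^a ⊗ ℂ^a)`. -/
def redOp (R : Op ((o × z) × (a × a))) : Op (z × (a × a)) :=
  traceFst (relabel (fun p : o × (z × (a × a)) => ((p.1, p.2.1), p.2.2)) R)

/-- `S^{1/2}`. -/
def sqrtOp {n : Type*} [Fintype n] [DecidableEq n] (S : Op n) : Op n :=
  cfc (fun x : ℝ => x ^ (1 / 2 : ℝ)) S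

/-- `S^{-1/2}`, inverted on the support of `S` and zero on the kernel of `S`. -/
def invSqrtOp {n : Type*} [Fintype n] [DecidableEq n] (S : Op n) : Op n :=
  cfc (fun x : ℝ => if x = 0 then 0 else x ^ (-1 / 2 : ℝ)) S

/-- The projection `S^{-1/2} S S^{-1/2}` on the support of `S`. -/
def suppOp {n : Type*} [Fintype n] [DecidableEq n] (S : Op n) : Op n :=
  invSqrtOp S * S * invSqrtOp S

/-- `|S^{1/2}⟩⟩⟨⟨S^{1/2}| * |I⟩⟩⟨⟨I|`. Here `|S^{1/2}⟩⟩` lies in `X ⊗ X'` with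
`X = ℂ^z ⊗ (ℂ^a ⊗ ℂ^a)` and `X'` a copy of `X`; the link is over the two factors `ℂ^a` of `X`.
In the result the first `ℂ^a` of `X'` is the system which is sent through the unitary, and the
other two factors of `X'` form the memory `ℂ^z ⊗ ℂ^a`. -/
def preOp (R : Op ((o × z) × (a × a))) : Op ((a × (z × a)) × z) :=
  relabel (fun p : (a × (z × a)) × z => ((p.1.2.1, (p.1.1, p.1.2.2)), p.2))
    (linkAll
      (relabel (fun p : ((z × (a × a)) × z) × (a × a) => ((p.1.2, p.2), p.1.1))
        (ketBra (sqrtOp (redOp R))))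
      (ketBra (1 : Op a)))

/-- `S^{-1/2} R S^{-1/2} + (1 / dim) I ⊗ (I - Π_S)`, with input `X' = ℂ^z ⊗ (ℂ^a ⊗ ℂ^a)`
regrouped into the first `ℂ^a` and the memory `ℂ^z ⊗ ℂ^a`. -/
def postOp (R : Op ((o × z) × (a × a))) : Op (o × (a × (z × a))) :=
  relabel (fun p : o × (a × (z × a)) => (p.1, (p.2.2.1, (p.2.1, p.2.2.2))))
    (((1 : Op o) ⊗ₖ invSqrtOp (redOp R)) *
        relabel (fun p : o × (z × (a × a)) => ((p.1, p.2.1), p.2.2)) R *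
        ((1 : Op o) ⊗ₖ invSqrtOp (redOp R)) +
      (1 / (Fintype.card o : ℂ)) • ((1 : Op o) ⊗ₖ (1 - suppOp (redOp R))))

end Explicit

end QComb

end

namespace QComb

/-! ### Positivity of link products -/

/-! Let `S` be the partial trace of `R` over its last output. Covariance at the pair `(g⁻¹, 1)`,
traced over that output, shows that `S`, hence `S^{1/2}`, commutes with the transpose of `U_g`
acting on the factor B alone. Read on `|S^{1/2}⟩⟩`, this is a ricochet identity: applying `U_g` to
the copy B' that leaves the preprocessing gives the same vector as contracting BA with `|U_g⟩⟩`
instead of `|I⟩⟩` (`amplitude_apply_of_commute`). So the state after the unitary call is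
`|S^{1/2}⟩⟩` contracted with `|U_g⟩⟩`, and feeding it to the postprocessing sandwiches `C₂` between
two factors `S^{1/2}` (`sum_amplitude`). These undo the factors `S^{-1/2}`, since `R` lives on the
support of `S`, and kill the term with `I - Π_S`; what is left is `R * |U_g⟩⟩⟨⟨U_g|`
(`linkCircuit_preOp_postOp`).

Normalisation is checked on Choi operators, where a channel is a positive operator whose partial
trace over the output is the identity. For `C₂` the two terms trace to `Π_S` and `I - Π_S`. For `C₁`
the trace is that of `R * |I⟩⟩⟨⟨I|`, which is the identity because `R` is evaluated on a product of
identity channels. Any two channels joined by a memory form a 2-comb, by associativity of the link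
and successive discarding of outputs. -/

theorem sum_sum_comm_sum_sum {α β γ δ M : Type*} [Fintype α] [Fintype β] [Fintype γ] [Fintype δ]
    [AddCommMonoid M] (f : α → β → γ → δ → M) :
    ∑ a, ∑ b, ∑ c, ∑ d, f a b c d = ∑ c, ∑ d, ∑ a, ∑ b, f a b c d := by
  have h := Finset.sum_comm (s := Finset.univ) (t := Finset.univ)
    (f := fun (x : α × β) (y : γ × δ) => f x.1 x.2 y.1 y.2)
  simpa only [Fintype.sum_prod_type] using h

open scoped MatrixOrder in
theorem exists_eq_conjTranspose_mul_self {n : Type*} [Fintype n] {M : Op n}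
    (hM : M.PosSemidef) : ∃ A : Op n, M = A.conjTranspose * A := by
  classical
  exact CStarAlgebra.nonneg_iff_eq_star_mul_self.mp hM.nonneg

/-- The partial transpose turns the link into an entrywise product summed over the shared indices,
so linking Gram matrices amounts to contracting their factors, with no conjugation left over. -/
theorem link_conjTranspose_mul_self {m k n r s : Type*} [Fintype m] [Fintype k] [Fintype n]
    [Fintype r] [Fintype s] [DecidableEq m] [DecidableEq n]
    (A : Matrix r (m × k) ℂ) (B : Matrix s (k × n) ℂ) :
    link (A.conjTranspose * A) (B.conjTranspose * B) =
      (Matrix.of fun (t : r × s) (p : m × n) => ∑ i, A t.1 (p.1, i) * B t.2 (i, p.2)).conjTranspose *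
        Matrix.of fun (t : r × s) (p : m × n) => ∑ i, A t.1 (p.1, i) * B t.2 (i, p.2) := by
  ext p q
  simp only [link_apply, Matrix.mul_apply, Matrix.conjTranspose_apply, Matrix.of_apply,
    Fintype.sum_prod_type, star_sum, star_mul', Finset.sum_mul_sum]
  rw [sum_sum_comm_sum_sum]
  exact Finset.sum_congr rfl fun _ _ => Finset.sum_congr rfl fun _ _ =>
    Finset.sum_congr rfl fun _ _ => Finset.sum_congr rfl fun _ _ => by ring

theorem link_posSemidef {m k n : Type*} [Fintype m] [Fintype k] [Fintype n]
    [DecidableEq m] [DecidableEq n] {M : Op (m × k)} {N : Op (k × n)}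
    (hM : M.PosSemidef) (hN : N.PosSemidef) : (link M N).PosSemidef := by
  classical
  obtain ⟨A, rfl⟩ := exists_eq_conjTranspose_mul_self hM
  obtain ⟨B, rfl⟩ := exists_eq_conjTranspose_mul_self hN
  rw [link_conjTranspose_mul_self]
  exact Matrix.posSemidef_conjTranspose_mul_self _

theorem relabel_posSemidef {m n : Type*} (f : m → n) {M : Op n} (hM : M.PosSemidef) :
    (relabel f M).PosSemidef := hM.submatrix f

theorem ketBra_posSemidef {m n : Type*} [Fintype m] [Fintype n] (A : Matrix m n ℂ) :
    (ketBra A).PosSemidef := Matrix.posSemidef_vecMulVec_self_star _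

theorem linkAll_apply {m k : Type*} [Fintype m] [Fintype k] [DecidableEq m]
    (M : Op (m × k)) (T : Op k) (p q : m) :
    linkAll M T p q = ∑ i, ∑ j, M (p, i) (q, j) * T i j := by
  simp [linkAll, relabel, link_apply]

/-! ### The Choi isomorphism -/

/-- The linear map with Choi operator `C`. -/
noncomputable def ofChoi {m n : Type*} [Fintype n] (C : Op (m × n)) : Op n →ₗ[ℂ] Op m where
  toFun X := Matrix.of fun p q => ∑ i, ∑ j, C (p, i) (q, j) * X i j
  map_add' X Y := by ext; simp [mul_add, Finset.sum_add_distrib]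
  map_smul' c X := by ext; simp [Finset.mul_sum, mul_left_comm]

theorem ofChoi_apply {m n : Type*} [Fintype n] (C : Op (m × n)) (X : Op n) (p q : m) :
    ofChoi C X p q = ∑ i, ∑ j, C (p, i) (q, j) * X i j := rfl

theorem choi_apply {m n : Type*} [DecidableEq n] (Φ : Op n →ₗ[ℂ] Op m) (p q : m × n) :
    choi Φ p q = Φ (Matrix.single p.2 q.2 1) p.1 q.1 := by
  have h : (Matrix.of fun a b => ketBra (1 : Op n) (a, p.2) (b, q.2)) =
      Matrix.single p.2 q.2 (1 : ℂ) := by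
    ext i j
    simp only [ketBra, dket, Matrix.vecMulVec_apply, Matrix.one_apply, Matrix.single_apply,
      Matrix.of_apply, Pi.star_apply]
    by_cases h : p.2 = i <;> by_cases h' : q.2 = j <;>
      simp [h, h', eq_comm (a := i), eq_comm (a := j)]
  exact congrArg (fun X => Φ X p.1 q.1) h

theorem ofChoi_choi {m n : Type*} [Fintype n] [DecidableEq n] (Φ : Op n →ₗ[ℂ] Op m) :
    ofChoi (choi Φ) = Φ := by
  refine Matrix.ext_linearMap (R := ℂ) fun i j => LinearMap.ext_ring (Matrix.ext fun p q => ?_)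
  simp [ofChoi_apply, choi_apply, Matrix.single_apply, ite_and]

theorem choi_ofChoi {m n : Type*} [Fintype n] [DecidableEq n] (C : Op (m × n)) :
    choi (ofChoi C) = C := by
  ext p q
  simp [choi_apply, ofChoi_apply, Matrix.single_apply, ite_and]

/-- Acting with the map on one half of `X` is the link of `C` with `X`, so positivity of links
suffices. -/
theorem isCP_ofChoi {m n : Type*} [Fintype m] [Fintype n] {C : Op (m × n)}
    (hC : C.PosSemidef) : IsCP (ofChoi C) := by
  classical
  intro k X hX
  have h : ampliation (Fin k) (ofChoi C) X = link C X := by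
    ext p q
    simp [ampliation, ofChoi_apply, link_apply]
  rw [h]
  exact link_posSemidef hC hX

theorem IsCP.choi_posSemidef {m n : Type*} [Fintype n] [DecidableEq n]
    {Φ : Op n →ₗ[ℂ] Op m} (h : IsCP Φ) : (choi Φ).PosSemidef := by
  -- Complete positivity only quantifies over ancillas `Fin k`, so the reference copy of `n` is
  -- enumerated here and renamed back afterwards.
  have h₁ := h _ _ (relabel_posSemidef (Prod.map id (Fintype.equivFin n).symm)
    (ketBra_posSemidef (1 : Op n)))
  have h₂ := relabel_posSemidef (Prod.map id (Fintype.equivFin n)) h₁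
  convert h₂ using 1
  ext p q
  simp [choi, ampliation, relabel]

theorem isOneComb_iff {m n : Type*} [Fintype m] [Fintype n] [DecidableEq n] {C : Op (m × n)} :
    IsOneComb C ↔ C.PosSemidef := by
  constructor
  · rintro ⟨Φ, h, rfl⟩
    exact h.choi_posSemidef
  · exact fun h => ⟨ofChoi C, isCP_ofChoi h, (choi_ofChoi C).symm⟩

theorem trace_ofChoi {m n : Type*} [Fintype m] [Fintype n] (C : Op (m × n)) (X : Op n) :
    (ofChoi C X).trace = ∑ i, ∑ j, traceFst C i j * X i j := by
  simp only [Matrix.trace, Matrix.diag, ofChoi_apply, traceFst, Matrix.of_apply, Finset.sum_mul]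
  rw [Finset.sum_comm]
  exact Finset.sum_congr rfl fun i _ => Finset.sum_comm

theorem isDetOneComb_iff {m n : Type*} [Fintype m] [Fintype n] [DecidableEq n] {C : Op (m × n)} :
    IsDetOneComb C ↔ C.PosSemidef ∧ traceFst C = 1 := by
  constructor
  · rintro ⟨Φ, h, rfl⟩
    refine ⟨h.1.choi_posSemidef, ?_⟩
    ext i j
    have h' := h.2 (Matrix.single i j 1)
    rw [← congrArg (fun Ψ => Ψ (Matrix.single i j 1)) (ofChoi_choi Φ), trace_ofChoi] at h'
    have h'' : ∑ x, ∑ y, traceFst (choi Φ) x y * Matrix.single i j (1 : ℂ) x y =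
        traceFst (choi Φ) i j := by
      simp [Matrix.single_apply, ite_and]
    rw [← h'', h', Matrix.one_apply]
    split_ifs with hij
    · rw [hij, Matrix.trace_single_eq_same]
    · rw [Matrix.trace_single_eq_of_ne _ _ _ hij]
  · rintro ⟨h, h'⟩
    refine ⟨ofChoi C, ⟨isCP_ofChoi h, fun X => ?_⟩, (choi_ofChoi C).symm⟩
    rw [trace_ofChoi, h']
    simp [Matrix.one_apply, Matrix.trace]

/-! ### Circuits -/

theorem linkInsert_apply {z b a μ : Type*} [Fintype z] [Fintype b] [Fintype a] [Fintype μ]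
    [DecidableEq z] [DecidableEq b] [DecidableEq μ]
    (C₁ : Op ((a × μ) × z)) (E : Op (b × a)) (p q : (b × μ) × z) :
    linkInsert C₁ E p q =
      ∑ i, ∑ j, E (p.1.1, i) (q.1.1, j) * C₁ ((i, p.1.2), p.2) ((j, q.1.2), q.2) := by
  simp [linkInsert, relabel, link_apply]

theorem linkMemory_apply {o z b a μ : Type*} [Fintype o] [Fintype z] [Fintype b] [Fintype a]
    [Fintype μ] [DecidableEq o] [DecidableEq z] [DecidableEq b] [DecidableEq a]
    (C₁ : Op ((a × μ) × z)) (C₂ : Op (o × (b × μ))) (p q : (o × z) × (b × a)) :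
    linkMemory C₁ C₂ p q = ∑ i, ∑ j, C₂ (p.1.1, (p.2.1, i)) (q.1.1, (q.2.1, j)) *
      C₁ ((p.2.2, i), p.1.2) ((q.2.2, j), q.1.2) := by
  simp [linkMemory, relabel, link_apply]

/-- Associativity of the link: both sides are the same finite sum in a different order. -/
theorem linkAll_linkMemory {o z b a μ : Type*} [Fintype o] [Fintype z] [Fintype b] [Fintype a]
    [Fintype μ] [DecidableEq o] [DecidableEq z] [DecidableEq b] [DecidableEq a] [DecidableEq μ]
    (C₁ : Op ((a × μ) × z)) (E : Op (b × a)) (C₂ : Op (o × (b × μ))) :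
    linkAll (linkMemory C₁ C₂) E = linkCircuit C₁ E C₂ := by
  ext p q
  simp only [linkAll_apply, linkMemory_apply, linkCircuit, link_apply, linkInsert_apply,
    Finset.sum_mul, Finset.mul_sum, Fintype.sum_prod_type]
  refine Finset.sum_congr rfl fun y _ => ?_
  rw [Finset.sum_comm, Finset.sum_comm (γ := μ)]
  refine Finset.sum_congr rfl fun y' _ => ?_
  rw [sum_sum_comm_sum_sum]
  exact Finset.sum_congr rfl fun _ _ => Finset.sum_congr rfl fun _ _ =>
    Finset.sum_congr rfl fun _ _ => Finset.sum_congr rfl fun _ _ => by ring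

theorem linkMemory_posSemidef {o z b a μ : Type*} [Fintype o] [Fintype z] [Fintype b] [Fintype a]
    [Fintype μ] [DecidableEq o] [DecidableEq z] [DecidableEq b] [DecidableEq a]
    {C₁ : Op ((a × μ) × z)} {C₂ : Op (o × (b × μ))} (h₁ : C₁.PosSemidef) (h₂ : C₂.PosSemidef) :
    (linkMemory C₁ C₂).PosSemidef :=
  relabel_posSemidef _ (link_posSemidef (relabel_posSemidef _ h₂) (relabel_posSemidef _ h₁))

theorem linkInsert_posSemidef {z b a μ : Type*} [Fintype z] [Fintype b] [Fintype a] [Fintype μ]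
    [DecidableEq z] [DecidableEq b] [DecidableEq μ]
    {C₁ : Op ((a × μ) × z)} {E : Op (b × a)} (h₁ : C₁.PosSemidef) (hE : E.PosSemidef) :
    (linkInsert C₁ E).PosSemidef :=
  relabel_posSemidef _ (link_posSemidef hE (relabel_posSemidef _ h₁))

/-- Causality: discarding the output of a channel is the same as discarding its input. -/
theorem traceFst_link {m k n : Type*} [Fintype m] [Fintype k] [Fintype n] [DecidableEq m]
    [DecidableEq n] [DecidableEq k] {M : Op (m × k)} (hM : traceFst M = 1) (N : Op (k × n)) :
    traceFst (link M N) = traceFst N := by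
  ext x y
  have h : traceFst (link M N) x y = ∑ i, ∑ j, traceFst M i j * N (i, x) (j, y) := by
    simp only [traceFst, Matrix.of_apply, link_apply, Finset.sum_mul]
    rw [Finset.sum_comm]
    exact Finset.sum_congr rfl fun i _ => Finset.sum_comm
  rw [h, hM]
  simp [Matrix.one_apply, traceFst]

theorem traceFst_linkInsert {z b a μ : Type*} [Fintype z] [Fintype b] [Fintype a] [Fintype μ]
    [DecidableEq z] [DecidableEq b] [DecidableEq μ] [DecidableEq a]
    (C₁ : Op ((a × μ) × z)) {E : Op (b × a)} (hE : traceFst E = 1) :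
    traceFst (linkInsert C₁ E) = traceFst C₁ := by
  ext x y
  have h := fun u => congrFun (congrFun (traceFst_link hE
    (relabel (fun p : a × (μ × z) => ((p.1, p.2.1), p.2.2)) C₁)) (u, x)) (u, y)
  simp only [traceFst, Matrix.of_apply, relabel, Matrix.submatrix_apply] at h
  simp only [linkInsert, traceFst, Matrix.of_apply, relabel, Matrix.submatrix_apply,
    Fintype.sum_prod_type]
  rw [Finset.sum_comm, Finset.sum_comm (γ := a)]
  exact Finset.sum_congr rfl fun u _ => h u

theorem linkCircuit_posSemidef {o z b a μ : Type*} [Fintype o] [Fintype z] [Fintype b] [Fintype a]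
    [Fintype μ] [DecidableEq o] [DecidableEq z] [DecidableEq b] [DecidableEq μ]
    {C₁ : Op ((a × μ) × z)} {E : Op (b × a)} {C₂ : Op (o × (b × μ))}
    (h₁ : C₁.PosSemidef) (hE : E.PosSemidef) (h₂ : C₂.PosSemidef) :
    (linkCircuit C₁ E C₂).PosSemidef :=
  link_posSemidef h₂ (linkInsert_posSemidef h₁ hE)

theorem isDetTwoComb_linkMemory {o z b a μ : Type*} [Fintype o] [Fintype z] [Fintype b]
    [Fintype a] [Fintype μ] [DecidableEq o] [DecidableEq z] [DecidableEq b] [DecidableEq a]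
    [DecidableEq μ] {C₁ : Op ((a × μ) × z)} {C₂ : Op (o × (b × μ))}
    (h₁ : IsDetOneComb C₁) (h₂ : IsDetOneComb C₂) : IsDetTwoComb (linkMemory C₁ C₂) := by
  rw [isDetOneComb_iff] at h₁ h₂
  have key : ∀ E, ofChoi (linkMemory C₁ C₂) E = linkCircuit C₁ E C₂ := fun E => by
    rw [← linkAll_linkMemory]
    ext p q
    rw [ofChoi_apply, linkAll_apply]
  refine ⟨ofChoi (linkMemory C₁ C₂), isCP_ofChoi (linkMemory_posSemidef h₁.1 h₂.1),
    fun C hC => ?_, fun C hC => ?_, (choi_ofChoi _).symm⟩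
  · rw [isOneComb_iff] at hC ⊢
    rw [key]
    exact linkCircuit_posSemidef h₁.1 hC h₂.1
  · rw [isDetOneComb_iff] at hC ⊢
    rw [key]
    refine ⟨linkCircuit_posSemidef h₁.1 hC.1 h₂.1, ?_⟩
    -- The discarded output eats the postprocessing, then the inserted channel, then the
    -- preprocessing.
    rw [linkCircuit, traceFst_link h₂.2, traceFst_linkInsert _ hC.2, h₁.2]

/-! ### Square roots and supports -/

section Functional

variable {n : Type*} [Fintype n] [DecidableEq n] {S : Op n}

/-- The spectrum is finite, so the functional calculus accepts even the inverse square root, which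
jumps at 0. -/
theorem continuousOn_real_spectrum (S : Op n) (f : ℝ → ℝ) : ContinuousOn f (spectrum ℝ S) :=
  (Matrix.finite_real_spectrum (A := S)).continuousOn f

open scoped MatrixOrder in
theorem nonneg_of_mem_real_spectrum (hS : S.PosSemidef) {x : ℝ} (hx : x ∈ spectrum ℝ S) :
    0 ≤ x :=
  spectrum_nonneg_of_nonneg hS.nonneg hx

theorem sqrtOp_isHermitian (S : Op n) : (sqrtOp S).IsHermitian :=
  cfc_predicate (p := IsSelfAdjoint) (fun x : ℝ => x ^ (1 / 2 : ℝ)) S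

theorem invSqrtOp_isHermitian (S : Op n) : (invSqrtOp S).IsHermitian :=
  cfc_predicate (p := IsSelfAdjoint) (fun x : ℝ => if x = 0 then 0 else x ^ (-1 / 2 : ℝ)) S

theorem sqrtOp_mul_self (hS : S.PosSemidef) : sqrtOp S * sqrtOp S = S := by
  rw [sqrtOp, ← cfc_mul _ _ S (continuousOn_real_spectrum S _) (continuousOn_real_spectrum S _)]
  refine (cfc_congr fun x hx => ?_).trans (cfc_id' ℝ S hS.1)
  have h := nonneg_of_mem_real_spectrum hS hx
  rw [← Real.rpow_add_of_nonneg h (by norm_num) (by norm_num)]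
  norm_num

theorem commute_sqrtOp_invSqrtOp (S : Op n) : Commute (sqrtOp S) (invSqrtOp S) :=
  cfc_commute_cfc _ _ S

theorem sqrtOp_mul_invSqrtOp_mul_sqrtOp (hS : S.PosSemidef) :
    sqrtOp S * invSqrtOp S * sqrtOp S = sqrtOp S := by
  have hc := continuousOn_real_spectrum S
  rw [sqrtOp, invSqrtOp, ← cfc_mul _ _ S (hc _) (hc _), ← cfc_mul _ _ S (hc _) (hc _)]
  refine cfc_congr fun x hx => ?_
  rcases (nonneg_of_mem_real_spectrum hS hx).eq_or_lt with h | h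
  · simp [← h]
  · simp only [h.ne', if_false]
    rw [← Real.rpow_add h, ← Real.rpow_add h]
    norm_num

theorem suppOp_eq (hS : S.PosSemidef) : suppOp S = sqrtOp S * invSqrtOp S := by
  have hc := (commute_sqrtOp_invSqrtOp S).eq
  have h := sqrtOp_mul_invSqrtOp_mul_sqrtOp hS
  calc suppOp S = invSqrtOp S * (sqrtOp S * sqrtOp S) * invSqrtOp S := by
        rw [suppOp, sqrtOp_mul_self hS]
    _ = (sqrtOp S * invSqrtOp S * sqrtOp S) * invSqrtOp S := by
        rw [← mul_assoc (invSqrtOp S), ← hc]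
    _ = _ := by rw [h]

theorem suppOp_eq' (hS : S.PosSemidef) : suppOp S = invSqrtOp S * sqrtOp S := by
  rw [suppOp_eq hS, (commute_sqrtOp_invSqrtOp S).eq]

theorem sqrtOp_mul_suppOp (hS : S.PosSemidef) : sqrtOp S * suppOp S = sqrtOp S := by
  rw [suppOp_eq' hS, ← mul_assoc, sqrtOp_mul_invSqrtOp_mul_sqrtOp hS]

theorem mul_suppOp (hS : S.PosSemidef) : S * suppOp S = S := by
  nth_rewrite 1 [← sqrtOp_mul_self hS]
  rw [mul_assoc, sqrtOp_mul_suppOp hS, sqrtOp_mul_self hS]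

theorem suppOp_isHermitian (hS : S.PosSemidef) : (suppOp S).IsHermitian := by
  rw [Matrix.IsHermitian, suppOp_eq hS, Matrix.conjTranspose_mul, (sqrtOp_isHermitian S).eq,
    (invSqrtOp_isHermitian S).eq, (commute_sqrtOp_invSqrtOp S).eq]

theorem suppOp_mul_self (hS : S.PosSemidef) : suppOp S * suppOp S = suppOp S := by
  nth_rewrite 1 [suppOp_eq' hS]
  rw [mul_assoc, sqrtOp_mul_suppOp hS, suppOp_eq' hS]

theorem one_sub_suppOp_posSemidef (hS : S.PosSemidef) : (1 - suppOp S).PosSemidef := by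
  have h : (1 - suppOp S).conjTranspose * (1 - suppOp S) = 1 - suppOp S := by
    rw [Matrix.conjTranspose_sub, Matrix.conjTranspose_one, (suppOp_isHermitian hS).eq, sub_mul,
      mul_sub, mul_sub, suppOp_mul_self hS]
    simp
  rw [← h]
  exact Matrix.posSemidef_conjTranspose_mul_self _

theorem commute_sqrtOp {A : Op n} (h : Commute S A) : Commute (sqrtOp S) A :=
  h.cfc_real _

end Functional

/-! ### Partial traces -/

theorem traceFst_posSemidef {o n : Type*} [Fintype o] {M : Op (o × n)} (hM : M.PosSemidef) :
    (traceFst M).PosSemidef := by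
  have h : traceFst M = ∑ i, relabel (fun x => (i, x)) M := by
    ext x y
    simp [traceFst, relabel, Matrix.sum_apply]
  rw [h]
  exact Matrix.posSemidef_sum _ fun i _ => relabel_posSemidef _ hM

theorem trace_traceFst {o n : Type*} [Fintype o] [Fintype n] (M : Op (o × n)) :
    (traceFst M).trace = M.trace := by
  simp only [Matrix.trace, Matrix.diag, traceFst, Matrix.of_apply, Fintype.sum_prod_type]
  exact Finset.sum_comm

section PartialTrace

variable {o n : Type*} [Fintype o] [Fintype n]

theorem traceFst_mul_one_kronecker [DecidableEq o] (M : Op (o × n)) (A : Op n) :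
    traceFst (M * ((1 : Op o) ⊗ₖ A)) = traceFst M * A := by
  ext x y
  have h : ∀ i, (M * ((1 : Op o) ⊗ₖ A)) (i, x) (i, y) = ∑ z, M (i, x) (i, z) * A z y := fun i => by
    simp [Matrix.mul_apply, Fintype.sum_prod_type, Matrix.one_apply]
  simp only [traceFst, Matrix.of_apply, Matrix.mul_apply (M := Matrix.of _), h, Finset.sum_mul]
  exact Finset.sum_comm

theorem traceFst_one_kronecker_mul [DecidableEq o] (M : Op (o × n)) (A : Op n) :
    traceFst (((1 : Op o) ⊗ₖ A) * M) = A * traceFst M := by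
  ext x y
  have h : ∀ i, (((1 : Op o) ⊗ₖ A) * M) (i, x) (i, y) = ∑ z, A x z * M (i, z) (i, y) := fun i => by
    simp [Matrix.mul_apply, Fintype.sum_prod_type, Matrix.one_apply]
  simp only [traceFst, Matrix.of_apply, Matrix.mul_apply (N := Matrix.of _), h, Finset.mul_sum]
  exact Finset.sum_comm

theorem traceFst_kronecker_one_mul_comm [DecidableEq n] (M : Op (o × n)) (V : Op o) :
    traceFst ((V ⊗ₖ (1 : Op n)) * M) = traceFst (M * (V ⊗ₖ (1 : Op n))) := by
  ext x y
  simp only [traceFst, Matrix.of_apply, Matrix.mul_apply, Fintype.sum_prod_type,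
    Matrix.kroneckerMap_apply, Matrix.one_apply, mul_ite, mul_one, mul_zero, ite_mul, zero_mul,
    Finset.sum_ite_eq, Finset.sum_ite_eq', Finset.mem_univ, if_true]
  rw [Finset.sum_comm]
  exact Finset.sum_congr rfl fun _ _ => Finset.sum_congr rfl fun _ _ => mul_comm _ _

/-- The partial trace is cyclic for operators acting on the traced factor only, so the invertible
`V` can be carried around `M` and cancelled, leaving `A`. -/
theorem commute_traceFst [DecidableEq o] [DecidableEq n] {M : Op (o × n)} {V V' : Op o}
    {A : Op n} (hV : V * V' = 1) (h : Commute M (V ⊗ₖ A)) : Commute (traceFst M) A := by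
  have hV' : V' * V = 1 := mul_eq_one_comm.mp hV
  have h₁ : ((1 : Op o) ⊗ₖ A) = (V ⊗ₖ A) * (V' ⊗ₖ 1) := by
    rw [← Matrix.mul_kronecker_mul, hV, mul_one]
  have h₂ : (V ⊗ₖ A) = ((1 : Op o) ⊗ₖ A) * (V ⊗ₖ 1) := by
    rw [← Matrix.mul_kronecker_mul, one_mul, mul_one]
  rw [Commute, SemiconjBy, ← traceFst_mul_one_kronecker, h₁, ← mul_assoc, h.eq, h₂]
  simp only [mul_assoc]
  rw [traceFst_one_kronecker_mul, traceFst_kronecker_one_mul_comm, mul_assoc,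
    ← Matrix.mul_kronecker_mul, hV', mul_one, Matrix.one_kronecker_one, mul_one]

/-- A positive operator is supported on the support of its partial trace. -/
theorem mul_one_kronecker_eq_zero [DecidableEq o] {M : Op (o × n)} (hM : M.PosSemidef) {P : Op n}
    (h : traceFst M * P = 0) : M * ((1 : Op o) ⊗ₖ P) = 0 := by
  obtain ⟨B, hB⟩ := exists_eq_conjTranspose_mul_self hM
  -- Its squared Hilbert–Schmidt norm is the trace of `P† (Tr_o M) P`, which vanishes.
  have h₁ : B * ((1 : Op o) ⊗ₖ P) = 0 := by
    rw [← Matrix.trace_conjTranspose_mul_self_eq_zero_iff, Matrix.conjTranspose_mul, mul_assoc,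
      ← mul_assoc B.conjTranspose, ← hB, Matrix.trace_mul_comm, mul_assoc,
      Matrix.conjTranspose_kronecker, ← Matrix.mul_kronecker_mul, Matrix.conjTranspose_one,
      one_mul, ← trace_traceFst, traceFst_mul_one_kronecker, ← mul_assoc, h, zero_mul,
      Matrix.trace_zero]
  rw [hB, mul_assoc, h₁, mul_zero]

theorem mul_one_kronecker_suppOp [DecidableEq o] [DecidableEq n] {M : Op (o × n)}
    (hM : M.PosSemidef) :
    M * ((1 : Op o) ⊗ₖ suppOp (traceFst M)) = M := by
  have h := mul_one_kronecker_eq_zero hM (P := 1 - suppOp (traceFst M)) (by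
    rw [mul_sub, mul_one, mul_suppOp (traceFst_posSemidef hM), sub_self])
  rw [← add_zero (M * _), ← h, ← mul_add, ← Matrix.kronecker_add, add_sub_cancel,
    Matrix.one_kronecker_one, mul_one]

theorem one_kronecker_suppOp_mul [DecidableEq o] [DecidableEq n] {M : Op (o × n)}
    (hM : M.PosSemidef) :
    ((1 : Op o) ⊗ₖ suppOp (traceFst M)) * M = M := by
  have h := congrArg Matrix.conjTranspose (mul_one_kronecker_suppOp hM)
  rwa [Matrix.conjTranspose_mul, Matrix.conjTranspose_kronecker, Matrix.conjTranspose_one,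
    (suppOp_isHermitian (traceFst_posSemidef hM)).eq, hM.1.eq] at h

end PartialTrace

/-! ### The explicit circuit -/

/-- Regrouping of `ℂ^a ⊗ (ℂ^z ⊗ ℂ^a)` as `ℂ^z ⊗ (ℂ^a ⊗ ℂ^a)`. -/
def regroup (z a : Type*) : a × (z × a) ≃ z × (a × a) where
  toFun p := (p.2.1, (p.1, p.2.2))
  invFun x := (x.2.1, (x.1, x.2.2))
  left_inv _ := rfl
  right_inv _ := rfl

/-- `R` as an operator on `ℂ^o ⊗ (ℂ^z ⊗ (ℂ^a ⊗ ℂ^a))`. -/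
def assocOp {o z a : Type*} (R : Op ((o × z) × (a × a))) : Op (o × (z × (a × a))) :=
  relabel (fun p => ((p.1, p.2.1), p.2.2)) R

theorem redOp_eq {o z a : Type*} [Fintype o] (R : Op ((o × z) × (a × a))) :
    redOp R = traceFst (assocOp R) := rfl

theorem redOp_posSemidef {o z a : Type*} [Fintype o] {R : Op ((o × z) × (a × a))}
    (hR : R.PosSemidef) : (redOp R).PosSemidef :=
  traceFst_posSemidef (relabel_posSemidef _ hR)

section Explicit

variable {o z a : Type*} [Fintype o] [Fintype z] [Fintype a]
  [DecidableEq z] [DecidableEq a]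

/-- The amplitudes of `|S^{1/2}⟩⟩` contracted with `|U⟩⟩`. -/
noncomputable def amplitude (R : Op ((o × z) × (a × a))) (U : Op a) (p : (a × (z × a)) × z) : ℂ :=
  ∑ c : a × a, U c.1 c.2 * sqrtOp (redOp R) (p.2, c) (regroup z a p.1)

theorem preOp_eq (R : Op ((o × z) × (a × a))) :
    preOp R = Matrix.vecMulVec (amplitude R 1) (star (amplitude R 1)) := by
  ext p q
  simp only [preOp, relabel, Matrix.submatrix_apply, linkAll_apply, ketBra, dket,
    Matrix.vecMulVec_apply, Pi.star_apply, amplitude, star_sum, star_mul', Finset.sum_mul_sum,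
    regroup, Equiv.coe_fn_mk]
  exact Finset.sum_congr rfl fun _ _ => Finset.sum_congr rfl fun _ _ => by ring

theorem amplitude_apply_of_commute {R : Op ((o × z) × (a × a))} {U : Op a}
    (hU : Commute (redOp R) ((1 : Op z) ⊗ₖ (U.transpose ⊗ₖ (1 : Op a)))) (b : a) (x : z × a)
    (w : z) : ∑ c, U b c * amplitude R 1 ((c, x), w) = amplitude R U ((b, x), w) := by
  have h : ∀ e : a, ∑ c, U b c * sqrtOp (redOp R) (w, (e, e)) (x.1, (c, x.2)) =
      ∑ f, U f e * sqrtOp (redOp R) (w, (f, e)) (x.1, (b, x.2)) := fun e => by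
    -- The diagonal row index `(e, e)` comes from contracting with `|I⟩⟩`; summing over `e` later
    -- yields the contraction with `|U⟩⟩`.
    have h₁ := congrFun (congrFun (commute_sqrtOp hU).eq (w, (e, e))) (x.1, (b, x.2))
    simpa [Matrix.mul_apply, Fintype.sum_prod_type, Matrix.one_apply, mul_comm] using h₁
  simp only [amplitude, regroup, Equiv.coe_fn_mk, Fintype.sum_prod_type, Matrix.one_apply,
    ite_mul, one_mul, zero_mul, Finset.sum_ite_eq, Finset.mem_univ, if_true, Finset.mul_sum]
  rw [Finset.sum_comm, Finset.sum_congr rfl fun e _ => h e, Finset.sum_comm]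

theorem linkInsert_preOp {R : Op ((o × z) × (a × a))} {U : Op a}
    (hU : Commute (redOp R) ((1 : Op z) ⊗ₖ (U.transpose ⊗ₖ (1 : Op a)))) :
    linkInsert (preOp R) (ketBra U) =
      Matrix.vecMulVec (amplitude R U) (star (amplitude R U)) := by
  ext p q
  rw [linkInsert_apply, preOp_eq]
  simp only [ketBra, dket, Matrix.vecMulVec_apply, Pi.star_apply]
  rw [← amplitude_apply_of_commute hU p.1.1 p.1.2 p.2,
    ← amplitude_apply_of_commute hU q.1.1 q.1.2 q.2,
    star_sum, Finset.sum_mul_sum]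
  exact Finset.sum_congr rfl fun _ _ => Finset.sum_congr rfl fun _ _ => by
    rw [star_mul']; ring

/-- Contracting both indices of `N` with amplitudes conjugates `N` by `S^{1/2}`. -/
theorem sum_amplitude (R : Op ((o × z) × (a × a))) (U : Op a) (N : Op (z × (a × a))) (w w' : z) :
    ∑ i, ∑ j, N (regroup z a i) (regroup z a j) *
        (amplitude R U (i, w) * star (amplitude R U (j, w'))) =
      ∑ c : a × a, ∑ e : a × a, (sqrtOp (redOp R) * N * sqrtOp (redOp R)) (w, c) (w', e) *
        (U c.1 c.2 * star (U e.1 e.2)) := by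
  have hT : ∀ x y, star (sqrtOp (redOp R) x y) = sqrtOp (redOp R) y x := fun x y =>
    (sqrtOp_isHermitian (redOp R)).apply y x
  have h : ∀ f : z × (a × a) → z × (a × a) → ℂ,
      ∑ i, ∑ j, f (regroup z a i) (regroup z a j) = ∑ x, ∑ y, f x y := fun f =>
    ((regroup z a).sum_comp fun x => ∑ j, f x (regroup z a j)).trans
      (Finset.sum_congr rfl fun x _ => (regroup z a).sum_comp (f x))
  simp only [amplitude]
  rw [h fun x y => N x y * ((∑ c : a × a, U c.1 c.2 * sqrtOp (redOp R) (w, c) x) *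
    star (∑ c : a × a, U c.1 c.2 * sqrtOp (redOp R) (w', c) y))]
  simp only [Matrix.mul_apply, star_sum, star_mul', hT, Finset.sum_mul,
    Finset.mul_sum]
  rw [sum_sum_comm_sum_sum, Finset.sum_comm]
  refine Finset.sum_congr rfl fun _ _ => Finset.sum_congr rfl fun _ _ => ?_
  rw [Finset.sum_comm]
  exact Finset.sum_congr rfl fun _ _ => Finset.sum_congr rfl fun _ _ => by ring

/-! ### Normalisation and positivity of the two explicit operators. -/

theorem traceFst_preOp [DecidableEq o] {R : Op ((o × z) × (a × a))} (hR : R.PosSemidef) :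
    traceFst (preOp R) = traceFst (linkAll R (ketBra (1 : Op a))) := by
  ext w w'
  -- Discarding all outputs puts the identity between the two square roots, which recombine to `S`.
  have h := sum_amplitude R 1 1 w w'
  simp only [Matrix.one_apply, (regroup z a).apply_eq_iff_eq, ite_mul, one_mul, zero_mul,
    Finset.sum_ite_eq, Finset.mem_univ, if_true, mul_one, sqrtOp_mul_self (redOp_posSemidef hR)]
    at h
  simp only [traceFst, Matrix.of_apply, preOp_eq, Matrix.vecMulVec_apply, Pi.star_apply,
    linkAll_apply, h, ketBra, dket, Matrix.one_apply, redOp, relabel, Matrix.submatrix_apply,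
    Finset.sum_mul]
  symm
  rw [Finset.sum_comm]
  refine Finset.sum_congr rfl fun _ _ => Finset.sum_comm.trans ?_
  simp only [ite_mul, one_mul, zero_mul]

/-- `S^{-1/2} R S^{-1/2} + (1 / dim) I ⊗ (I - Π_S)` before regrouping. -/
noncomputable def postCore [DecidableEq o] (R : Op ((o × z) × (a × a))) : Op (o × (z × (a × a))) :=
  ((1 : Op o) ⊗ₖ invSqrtOp (redOp R)) * assocOp R * ((1 : Op o) ⊗ₖ invSqrtOp (redOp R)) +
    (1 / (Fintype.card o : ℂ)) • ((1 : Op o) ⊗ₖ (1 - suppOp (redOp R)))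

theorem postOp_apply [DecidableEq o] (R : Op ((o × z) × (a × a))) (p q : o × (a × (z × a))) :
    postOp R p q = postCore R (p.1, regroup z a p.2) (q.1, regroup z a q.2) := rfl

theorem postCore_posSemidef [DecidableEq o] {R : Op ((o × z) × (a × a))} (hR : R.PosSemidef) :
    (postCore R).PosSemidef := by
  refine Matrix.PosSemidef.add ?_ (Matrix.PosSemidef.smul ?_ ?_)
  · have h := (relabel_posSemidef _ hR : (assocOp R).PosSemidef).conjTranspose_mul_mul_same
      ((1 : Op o) ⊗ₖ invSqrtOp (redOp R))
    rwa [Matrix.conjTranspose_kronecker, Matrix.conjTranspose_one,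
      (invSqrtOp_isHermitian (redOp R)).eq] at h
  · exact Matrix.PosSemidef.one.kronecker (one_sub_suppOp_posSemidef (redOp_posSemidef hR))
  · positivity

/-- The first term traces to `S^{-1/2} S S^{-1/2}`, which is `Π_S` by definition; the second to its
complement, where a nonempty `o` lets the dimension cancel. -/
theorem traceFst_postCore [DecidableEq o] [Nonempty o] {R : Op ((o × z) × (a × a))} :
    traceFst (postCore R) = 1 := by
  have h₁ : traceFst ((1 : Op o) ⊗ₖ (1 - suppOp (redOp R))) =
      (Fintype.card o : ℂ) • (1 - suppOp (redOp R)) := by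
    ext x y
    simp [traceFst, mul_sub]
  have h₂ : ∀ A B : Op (o × (z × (a × a))), traceFst (A + B) = traceFst A + traceFst B := by
    intro A B
    ext x y
    simp [traceFst, Finset.sum_add_distrib]
  have h₃ : ∀ (c : ℂ) (A : Op (o × (z × (a × a)))), traceFst (c • A) = c • traceFst A := by
    intro c A
    ext x y
    simp [traceFst, Finset.mul_sum]
  rw [postCore, h₂, h₃, h₁, traceFst_mul_one_kronecker, traceFst_one_kronecker_mul, ← redOp_eq,
    ← suppOp, smul_smul, one_div, inv_mul_cancel₀ (by simp), one_smul, add_sub_cancel]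

theorem isDetOneComb_postOp [DecidableEq o] (h : z → Nonempty o) {R : Op ((o × z) × (a × a))}
    (hR : R.PosSemidef) : IsDetOneComb (postOp R) := by
  rw [isDetOneComb_iff]
  refine ⟨relabel_posSemidef _ (postCore_posSemidef hR), ?_⟩
  ext x y
  -- A matrix index contains a label in `z`, so the degenerate case of an empty `o` never needs the
  -- division by the dimension.
  have := h x.2.1
  have h₁ := congrFun (congrFun (traceFst_postCore (R := R)) (regroup z a x)) (regroup z a y)
  refine h₁.trans ?_
  simp only [Matrix.one_apply, (regroup z a).apply_eq_iff_eq]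

theorem isDetOneComb_preOp [DecidableEq o] {R : Op ((o × z) × (a × a))} (hR : R.PosSemidef)
    (h : traceFst (linkAll R (ketBra (1 : Op a))) = 1) : IsDetOneComb (preOp R) := by
  rw [isDetOneComb_iff, traceFst_preOp hR]
  refine ⟨?_, h⟩
  rw [preOp_eq]
  exact Matrix.posSemidef_vecMulVec_self_star _

/-- The products of `S^{1/2}` and `S^{-1/2}` are `Π_S`, which fixes `R` from either side, while
`S^{1/2}` annihilates the completing term. -/
theorem sqrtOp_mul_postCore_mul_sqrtOp [DecidableEq o] {R : Op ((o × z) × (a × a))}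
    (hR : R.PosSemidef) :
    ((1 : Op o) ⊗ₖ sqrtOp (redOp R)) * postCore R * ((1 : Op o) ⊗ₖ sqrtOp (redOp R)) =
      assocOp R := by
  have hS := redOp_posSemidef hR
  have hA : (assocOp R).PosSemidef := relabel_posSemidef _ hR
  have h₁ : ((1 : Op o) ⊗ₖ sqrtOp (redOp R)) * ((1 : Op o) ⊗ₖ invSqrtOp (redOp R)) =
      (1 : Op o) ⊗ₖ suppOp (redOp R) := by
    rw [← Matrix.mul_kronecker_mul, one_mul, suppOp_eq hS]
  have h₂ : ((1 : Op o) ⊗ₖ invSqrtOp (redOp R)) * ((1 : Op o) ⊗ₖ sqrtOp (redOp R)) =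
      (1 : Op o) ⊗ₖ suppOp (redOp R) := by
    rw [← Matrix.mul_kronecker_mul, one_mul, suppOp_eq' hS]
  have h₃ : ((1 : Op o) ⊗ₖ sqrtOp (redOp R)) * ((1 : Op o) ⊗ₖ (1 - suppOp (redOp R))) = 0 := by
    rw [← Matrix.mul_kronecker_mul, mul_sub, mul_one, mul_one, sqrtOp_mul_suppOp hS, sub_self,
      Matrix.kronecker_zero]
  rw [postCore, mul_add, add_mul, Matrix.mul_smul, h₃, smul_zero, zero_mul, add_zero,
    ← mul_assoc, ← mul_assoc, h₁, mul_assoc, h₂, redOp_eq, one_kronecker_suppOp_mul hA,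
    mul_one_kronecker_suppOp hA]

theorem linkCircuit_preOp_postOp [DecidableEq o] {R : Op ((o × z) × (a × a))}
    (hR : R.PosSemidef) {U : Op a}
    (hU : Commute (redOp R) ((1 : Op z) ⊗ₖ (U.transpose ⊗ₖ (1 : Op a)))) :
    linkCircuit (preOp R) (ketBra U) (postOp R) = linkAll R (ketBra U) := by
  ext p q
  have h : ∀ x y, (sqrtOp (redOp R) * (Matrix.of fun i j => postCore R (p.1, i) (q.1, j)) *
      sqrtOp (redOp R)) x y = assocOp R (p.1, x) (q.1, y) := by
    intro x y
    rw [← sqrtOp_mul_postCore_mul_sqrtOp hR]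
    simp [Matrix.mul_apply, Fintype.sum_prod_type, Matrix.one_apply]
  rw [linkCircuit, linkInsert_preOp hU, link_apply]
  simp only [postOp_apply, Matrix.vecMulVec_apply, Pi.star_apply]
  refine (sum_amplitude R U (Matrix.of fun i j => postCore R (p.1, i) (q.1, j)) p.2 q.2).trans ?_
  simp only [h, linkAll_apply]
  rfl

end Explicit

/-! ### Tensor products -/

section Tensor

variable {ι : Type*} [Fintype ι]

theorem tensorPi_one {n : ι → Type*} [∀ i, DecidableEq (n i)] [DecidableEq ι] :
    tensorPi (fun i => (1 : Op (n i))) = 1 := by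
  ext x y
  simp [tensorPi, Matrix.one_apply, Finset.prod_ite_zero, funext_iff]

theorem tensorPi_conjTranspose {m n : ι → Type*} (A : ∀ i, Matrix (m i) (n i) ℂ) :
    tensorPi (fun i => (A i).conjTranspose) = (tensorPi A).conjTranspose := by
  ext x y
  simp [tensorPi]

theorem tensorCombs_ketBra {b a : ι → Type*} (A : ∀ i, Matrix (b i) (a i) ℂ) :
    tensorCombs (fun i => ketBra (A i)) = ketBra (tensorPi A) := by
  ext x y
  simp [tensorCombs, tensorPi, relabel, ketBra, dket, Matrix.vecMulVec_apply,
    Finset.prod_mul_distrib]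

theorem isDetOneComb_ketBra_one {n : Type*} [Fintype n] [DecidableEq n] :
    IsDetOneComb (ketBra (1 : Op n)) := by
  rw [isDetOneComb_iff]
  refine ⟨ketBra_posSemidef _, ?_⟩
  ext x y
  simp [traceFst, ketBra, dket, Matrix.vecMulVec_apply, Matrix.one_apply, eq_comm]

end Tensor

/-! ### What a parallel comb provides: positivity and normalisation. -/

section Parallel

variable {N : ℕ} {o z : Type*} {b a : Fin N → Type*} [Fintype o] [Fintype z]
  [∀ i, Fintype (b i)] [∀ i, Fintype (a i)] [DecidableEq z]
  [∀ i, DecidableEq (b i)] [∀ i, DecidableEq (a i)]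

theorem IsDetParallelComb.posSemidef {R : Op ((o × z) × ((∀ i, b i) × (∀ i, a i)))}
    (hR : IsDetParallelComb R) : R.PosSemidef := by
  obtain ⟨Φ, hΦ, -, -, rfl⟩ := hR
  exact hΦ.choi_posSemidef

theorem IsDetParallelComb.traceFst_linkAll [DecidableEq o]
    {R : Op ((o × z) × ((∀ i, b i) × (∀ i, a i)))}
    (hR : IsDetParallelComb R) {C : ∀ i, Op (b i × a i)} (hC : ∀ i, IsDetOneComb (C i)) :
    traceFst (linkAll R (tensorCombs C)) = 1 := by
  obtain ⟨Φ, -, -, h, rfl⟩ := hR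
  have h₁ : linkAll (choi Φ) (tensorCombs C) = Φ (tensorCombs C) := by
    conv_rhs => rw [← ofChoi_choi Φ]
    ext p q
    rw [linkAll_apply, ofChoi_apply]
  rw [h₁]
  exact (isDetOneComb_iff.mp (h C hC)).2

end Parallel

theorem commute_redOp {o z a : Type*} [Fintype o] [Fintype z] [Fintype a] [DecidableEq o]
    [DecidableEq z] [DecidableEq a] {R : Op ((o × z) × (a × a))} {V V' : Op o} {W : Op z}
    {A B : Op a} (hV : V * V' = 1) (h : Commute R ((V ⊗ₖ W) ⊗ₖ (A ⊗ₖ B))) :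
    Commute (redOp R) (W ⊗ₖ (A ⊗ₖ B)) := by
  refine commute_traceFst hV ?_
  let e : o × (z × (a × a)) ≃ (o × z) × (a × a) := (Equiv.prodAssoc o z (a × a)).symm
  have h₁ : (V ⊗ₖ (W ⊗ₖ (A ⊗ₖ B))) = relabel e ((V ⊗ₖ W) ⊗ₖ (A ⊗ₖ B)) := by
    ext x y
    simp [relabel, e, mul_assoc]
  have h₂ : ∀ X Y : Op ((o × z) × (a × a)), relabel e X * relabel e Y = relabel e (X * Y) :=
    fun X Y => Matrix.submatrix_mul_equiv X Y e e e
  rw [h₁]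
  change relabel e R * _ = _ * relabel e R
  rw [h₂, h₂, h.eq]

end QComb

theorem mainTheorem1 {G : Type*} [Group G] (N d₀ : ℕ) (d : Fin N → ℕ)
    (U : ∀ i, G →* Matrix.unitaryGroup (Fin (d i)) ℂ)
    (V : G →* Matrix.unitaryGroup (Fin d₀) ℂ)
    (R : QComb.Op ((Fin d₀ × Fin d₀) × ((∀ i, Fin (d i)) × (∀ i, Fin (d i)))))
    (hR : QComb.IsDetParallelComb R)
    (hcov : ∀ g h : G, Commute R
      (((V g : Matrix (Fin d₀) (Fin d₀) ℂ) ⊗ₖ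
          (V h : Matrix (Fin d₀) (Fin d₀) ℂ).map (starRingEnd ℂ)) ⊗ₖ
        ((QComb.tensorPi fun i => (U i g : Matrix (Fin (d i)) (Fin (d i)) ℂ)).map (starRingEnd ℂ) ⊗ₖ
          QComb.tensorPi fun i => (U i h : Matrix (Fin (d i)) (Fin (d i)) ℂ)))) :
    ∃ (C₁ : QComb.Op (((∀ i, Fin (d i)) × (Fin d₀ × (∀ i, Fin (d i)))) × Fin d₀))
      (C₂ : QComb.Op (Fin d₀ × ((∀ i, Fin (d i)) × (Fin d₀ × (∀ i, Fin (d i)))))),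
      QComb.IsDetOneComb C₁ ∧ QComb.IsDetOneComb C₂ ∧
      QComb.IsDetTwoComb (QComb.linkMemory C₁ C₂) ∧
      (∀ g : G,
        QComb.linkAll R
            (QComb.ketBra (QComb.tensorPi fun i => (U i g : Matrix (Fin (d i)) (Fin (d i)) ℂ))) =
          QComb.linkAll (QComb.linkMemory C₁ C₂)
            (QComb.ketBra (QComb.tensorPi fun i => (U i g : Matrix (Fin (d i)) (Fin (d i)) ℂ))) ∧
        QComb.linkAll R
            (QComb.ketBra (QComb.tensorPi fun i => (U i g : Matrix (Fin (d i)) (Fin (d i)) ℂ))) =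
          QComb.linkCircuit C₁
            (QComb.ketBra (QComb.tensorPi fun i => (U i g : Matrix (Fin (d i)) (Fin (d i)) ℂ)))
            C₂) ∧
      C₁ = QComb.preOp R ∧ C₂ = QComb.postOp R := by
  have hPos := hR.posSemidef
  have h₁ : QComb.IsDetOneComb (QComb.preOp R) := by
    refine QComb.isDetOneComb_preOp hPos ?_
    -- The identity on the joint system is a product of identity channels, an admissible input of
    -- the parallel comb.
    rw [← QComb.tensorPi_one, ← QComb.tensorCombs_ketBra]
    exact hR.traceFst_linkAll fun i => QComb.isDetOneComb_ketBra_one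
  have h₂ : QComb.IsDetOneComb (QComb.postOp R) := QComb.isDetOneComb_postOp (fun x => ⟨x⟩) hPos
  have h₃ : ∀ g : G,
      QComb.linkCircuit (QComb.preOp R)
        (QComb.ketBra (QComb.tensorPi fun i => (U i g : Matrix (Fin (d i)) (Fin (d i)) ℂ)))
        (QComb.postOp R) =
      QComb.linkAll R
        (QComb.ketBra (QComb.tensorPi fun i => (U i g : Matrix (Fin (d i)) (Fin (d i)) ℂ))) := by
    intro g
    refine QComb.linkCircuit_preOp_postOp hPos ?_
    have hV : (V g⁻¹ : Matrix (Fin d₀) (Fin d₀) ℂ) * V g = 1 := by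
      rw [← Submonoid.coe_mul, ← map_mul, inv_mul_cancel, map_one, Submonoid.coe_one]
    -- With `h = 1` only the factor B is acted on; the inverse of `g` makes the conjugate of the
    -- unitary into the transpose of `U_g`.
    have h := QComb.commute_redOp hV (hcov g⁻¹ 1)
    have hU : (QComb.tensorPi fun i => (U i g⁻¹ : Matrix (Fin (d i)) (Fin (d i)) ℂ)).map
        (starRingEnd ℂ) =
        (QComb.tensorPi fun i => (U i g : Matrix (Fin (d i)) (Fin (d i)) ℂ)).transpose := by
      have h' : (fun i => (U i g⁻¹ : Matrix (Fin (d i)) (Fin (d i)) ℂ)) =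
          fun i => (U i g : Matrix (Fin (d i)) (Fin (d i)) ℂ).conjTranspose := by
        funext i
        rw [map_inv]
        rfl
      rw [h', QComb.tensorPi_conjTranspose]
      ext x y
      simp
    rw [hU] at h
    simpa [QComb.tensorPi_one] using h
  exact ⟨_, _, h₁, h₂, QComb.isDetTwoComb_linkMemory h₁ h₂,
    fun g => ⟨by rw [QComb.linkAll_linkMemory, h₃], (h₃ g).symm⟩, rfl, rfl⟩
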